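/- Let $E$ be a finite set and $M$ a matroid on $E$. A family $\mathcal A=(A_1,\dots,A_k)$ of subsets of $E$ is a presentation of $M$ if the independent sets of $M$ are exactly the partial transversals of $\mathcal A$, i.e. the sets $\{e_j: j\in J\}$ with $J\subseteq[k]$ and the $e_j\in A_j$ distinct. A representation of $\mathcal A$ is the $0/1$ matrix $X$, with rows indexed by $E$ and columns by $[k]$, such that $X_{ej}=1$ iff $e\in A_j$; it is viable if $k$ equals the rank $r$ of $M$. On presentations of $M$ by $r$ sets write $\mathcal A\le\mathcal B$ if for some permutation $\sigma$ of $[r]$ one has $A_{\sigma(i)}\subseteq B_i$ for all $i\in[r]$; a presentation by $r$ sets is maximal if it is a maximal element for this relation (that is, $\mathcal A\le\mathcal B$ implies $\mathcal B\le\mathcal A$), and a representation is maximal if it represents a maximal presentation. Algorithm 1. Input: a viable representation $X$. Let $G$ be the bipartite graph on $E\sqcup[r]$ with edge set $\{(e,j):X_{ej}\neq0\}$. For $j=1,\dots,r$ in turn: let $G_j$ be the subgraph of the current $G$ induced on $\{e\in E:(e,j)\notin E(G)\}\sqcup([r]\setminus\{j\})$; let $\mathcal M_j$ be the collection of the largest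 sets $S$ of left vertices of $G_j$ that can be completely matched in $G_j$ into the right vertices; and add to $G$ the edge $(e,j)$ for every $e\in\bigcap_{S\in\mathcal M_j}S$. Output: the biadjacency matrix of the final $G$. Theorem. Let $X$ be a viable representation of a presentation $\mathcal A=(A_1,\dots,A_r)$ of the matroid $M$ of rank $r$. Then the output of Algorithm 1 on $X$ is a maximal representation of $M$. More precisely, it represents the family $\mathcal B=(B_1,\dots,B_r)$, where $B_j$ is the union of $A_j$ and the set of all coloops of $M\setminus A_j$; the family $\mathcal B$ is a maximal presentation of $M$; every presentation $\mathcal C$ of $M$ by $r$ sets satisfies $\mathcal C\le\mathcal B$; and every maximal presentation of $M$ is obtained from $\mathcal B$ by permuting its sets. -/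

import Mathlib

namespace TransversalPresentation

/-- `I` is (the underlying set of) a partial transversal of the family `A`: there are a set `J` of
indices and distinct elements `e j ∈ A j`, for `j ∈ J`, with `I = {e j : j ∈ J}`. -/
def IsPartialTransversal {E : Type*} {k : ℕ} (A : Fin k → Set E) (I : Set E) : Prop :=
  ∃ (J : Set (Fin k)) (e : J → E),
    Function.Injective e ∧ (∀ j : J, e j ∈ A j) ∧ Set.range e = I

/-- `A` is a presentation of the matroid `M` on the set `E`, that is, `M = M[A]`: the independent
sets of `M` are the partial transversals of `A`. -/
def IsPresentation {E : Type*} {k : ℕ} (M : Matroid E) (A : Fin k → Set E) : Prop :=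
  M.E = Set.univ ∧ ∀ I : Set E, M.Indep I ↔ IsPartialTransversal A I

/-- The order on presentations with `k` sets: `A ≤ B` iff, for some permutation `σ`,
`A (σ i) ⊆ B i` for all `i`. -/
def PresentationLE {E : Type*} {k : ℕ} (A B : Fin k → Set E) : Prop :=
  ∃ σ : Equiv.Perm (Fin k), ∀ i, A (σ i) ⊆ B i

/-- `A` is a maximal presentation of `M`: a presentation by `rank M` sets that is a maximal element
among all such presentations. -/
def IsMaximalPresentation {E : Type*} {k : ℕ} (M : Matroid E) (A : Fin k → Set E) : Prop :=
  IsPresentation M A ∧ M.eRank = k ∧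
    ∀ B : Fin k → Set E, IsPresentation M B → PresentationLE A B → PresentationLE B A

/-- The edge set of the bipartite graph with left vertices `E` and right vertices `Fin k` in which
`e` and `j` are adjacent iff `e ∈ A j`. -/
def edgesOfFamily {E : Type*} {k : ℕ} (A : Fin k → Set E) : Set (E × Fin k) :=
  {p | p.1 ∈ A p.2}

open Classical in
/-- The biadjacency matrix of the bipartite graph on `E ⊔ Fin k` with edge set `G`. -/
noncomputable def biadjacency {E : Type*} {k : ℕ} (G : Set (E × Fin k)) : Matrix E (Fin k) ℕ :=
  Matrix.of fun e j => if (e, j) ∈ G then 1 else 0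

/-- `X` represents the family `A`: it is the biadjacency matrix of the bipartite graph of `A`. -/
def IsRepresentation {E : Type*} {k : ℕ} (A : Fin k → Set E) (X : Matrix E (Fin k) ℕ) : Prop :=
  X = biadjacency (edgesOfFamily A)

/-- `X` is a viable representation of the presentation `A` of `M`: the number of sets in `A` is the
rank of `M`. -/
def IsViableRepresentation {E : Type*} {k : ℕ} (M : Matroid E) (A : Fin k → Set E)
    (X : Matrix E (Fin k) ℕ) : Prop :=
  IsPresentation M A ∧ IsRepresentation A X ∧ M.eRank = k

/-- `X` is a maximal representation of `M`: it represents a maximal presentation of `M`. -/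
def IsMaximalRepresentation {E : Type*} {k : ℕ} (M : Matroid E)
    (X : Matrix E (Fin k) ℕ) : Prop :=
  ∃ A : Fin k → Set E, IsMaximalPresentation M A ∧ IsRepresentation A X

/-- The edge set of the bipartite graph described by the matrix `X`. -/
def edgesOfMatrix {E : Type*} {k : ℕ} (X : Matrix E (Fin k) ℕ) : Set (E × Fin k) :=
  {p | X p.1 p.2 ≠ 0}

/-- The left vertices of `G_j`: those not adjacent to the right vertex `j` in `G`. -/
def leftVertices {E : Type*} {k : ℕ} (G : Set (E × Fin k)) (j : Fin k) : Set E :=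
  {a | (a, j) ∉ G}

/-- The right vertices of `G_j`: all those other than `j`. -/
def rightVertices {k : ℕ} (j : Fin k) : Set (Fin k) :=
  {b | b ≠ j}

/-- The edges of `G_j`, the subgraph of `G` induced on `leftVertices G j ⊔ rightVertices j`. -/
def inducedEdges {E : Type*} {k : ℕ} (G : Set (E × Fin k)) (j : Fin k) : Set (E × Fin k) :=
  {p | p ∈ G ∧ p.1 ∈ leftVertices G j ∧ p.2 ∈ rightVertices j}

/-- `S` is a set of left vertices of `G_j` that can be completely matched in `G_j` into the right
vertices of `G_j`. -/
def IsMatchable {E : Type*} {k : ℕ} (G : Set (E × Fin k)) (j : Fin k) (S : Finset E) : Prop :=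
  (S : Set E) ⊆ leftVertices G j ∧
    ∃ f : S → rightVertices j,
      Function.Injective f ∧ ∀ s : S, ((s : E), (f s : Fin k)) ∈ inducedEdges G j

/-- The collection `M_j` of the matchable sets of left vertices of `G_j` of the largest size. -/
def maximumMatchable {E : Type*} {k : ℕ} (G : Set (E × Fin k)) (j : Fin k) : Set (Finset E) :=
  {S | IsMatchable G j S ∧ ∀ S' : Finset E, IsMatchable G j S' → S'.card ≤ S.card}

/-- The body of the loop: join `j` to every left vertex that lies in all members of `M_j`. -/
def step {E : Type*} {k : ℕ} (G : Set (E × Fin k)) (j : Fin k) : Set (E × Fin k) :=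
  G ∪ {p | p.2 = j ∧ ∀ S ∈ maximumMatchable G j, p.1 ∈ S}

/-- The algorithm: start from the graph of `X`, run the body of the loop once for each column, in
increasing order, and return the biadjacency matrix of the resulting graph. -/
noncomputable def algorithm {E : Type*} {k : ℕ} (X : Matrix E (Fin k) ℕ) : Matrix E (Fin k) ℕ :=
  biadjacency ((List.finRange k).foldl step (edgesOfMatrix X))

end TransversalPresentation

namespace TransversalPresentation

open Set

variable {E : Type*} {k : ℕ}

/-! By Hall's theorem a circuit has fewer neighbours among the sets than elements. Hence a union of
circuits `F` has exactly as many neighbours as its rank, so the number of sets avoiding `F` is the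
same in all presentations with equally many sets (`ncard_subset_compl_eq`). Adding to a set the
coloops of its deletion keeps the presentation and makes the complement a union of circuits.
Inclusion counts then recover these complements with multiplicity, so any two presentations have the
same extended sets up to order (`exists_perm_coloopExtension_eq`). Since each set lies in its
extension, the extended family is the greatest presentation. The algorithm computes it because the
largest matchable sets are the bases of `M ＼ A j`, whose intersection is the set of coloops. -/

/-- The indices of the members of the family `A` that meet `S`. -/
def neighbors (A : Fin k → Set E) (S : Set E) : Set (Fin k) :=
  {j | ∃ e ∈ S, e ∈ A j}

lemma neighbors_mono (A : Fin k → Set E) {S T : Set E} (h : S ⊆ T) :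
    neighbors A S ⊆ neighbors A T :=
  fun _ ⟨e, he, hj⟩ ↦ ⟨e, h he, hj⟩

/-! ### Matchings, circuits and Hall's condition -/

/-- `f` matches the elements of `S` to distinct members of the family `A` containing them. -/
def IsMatching (A : Fin k → Set E) (S : Set E) (f : S → Fin k) : Prop :=
  Function.Injective f ∧ ∀ s : S, (s : E) ∈ A (f s)

lemma isPartialTransversal_iff_exists_isMatching {A : Fin k → Set E} {S : Set E} :
    IsPartialTransversal A S ↔ ∃ f : S → Fin k, IsMatching A S f := by
  constructor
  · rintro ⟨J, e, he, heA, rfl⟩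
    refine ⟨fun s ↦ ((Equiv.ofInjective e he).symm s : J), ?_, fun s ↦ ?_⟩
    · exact Subtype.val_injective.comp (Equiv.injective _)
    · obtain ⟨_, j, rfl⟩ := s
      simpa [Equiv.ofInjective_symm_apply] using heA j
  · rintro ⟨f, hf, hfA⟩
    refine ⟨range f, fun j ↦ ((Equiv.ofInjective f hf).symm j : S), ?_, ?_, ?_⟩
    · exact Subtype.val_injective.comp (Equiv.injective _)
    · rintro ⟨_, s, rfl⟩
      simpa [Equiv.ofInjective_symm_apply] using hfA s
    · ext x
      constructor
      · rintro ⟨j, rfl⟩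
        exact Subtype.coe_prop _
      · intro hx
        exact ⟨⟨f ⟨x, hx⟩, mem_range_self _⟩, by simp [Equiv.ofInjective_symm_apply]⟩

lemma IsPresentation.indep_iff {M : Matroid E} {A : Fin k → Set E} (hA : IsPresentation M A)
    {S : Set E} : M.Indep S ↔ ∃ f : S → Fin k, IsMatching A S f :=
  (hA.2 S).trans isPartialTransversal_iff_exists_isMatching

lemma IsMatching.ncard_image [Finite E] {A : Fin k → Set E} {S T : Set E} {f : S → Fin k}
    (hf : IsMatching A S f) (hT : T ⊆ S) : (f '' (Subtype.val ⁻¹' T)).ncard = T.ncard := by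
  rw [ncard_image_of_injective _ hf.1, ncard_preimage_of_injective_subset_range
    Subtype.val_injective (by simpa using hT)]

lemma IsMatching.image_subset_neighbors {A : Fin k → Set E} {S T : Set E} {f : S → Fin k}
    (hf : IsMatching A S f) : f '' (Subtype.val ⁻¹' T) ⊆ neighbors A T := by
  rintro _ ⟨s, hs, rfl⟩
  exact ⟨s, hs, hf.2 s⟩

/-- Hall's marriage theorem for finite set systems on a finite ground set. -/
lemma exists_isMatching_of_ncard_le_neighbors [Finite E] {A : Fin k → Set E} {S : Set E}
    (h : ∀ T ⊆ S, T.ncard ≤ (neighbors A T).ncard) : ∃ f : S → Fin k, IsMatching A S f := by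
  classical
  obtain ⟨f, hf, hfA⟩ := (Finset.all_card_le_biUnion_card_iff_exists_injective
    (fun s : S ↦ Finset.univ.filter fun j ↦ (s : E) ∈ A j)).1 (fun T ↦ by
      have hT := h (Subtype.val '' (T : Set S)) (by rintro _ ⟨s, -, rfl⟩; exact s.2)
      rw [ncard_image_of_injective _ Subtype.val_injective, ncard_coe_finset] at hT
      refine hT.trans (le_of_eq ?_)
      rw [← ncard_coe_finset]
      congr 1
      ext j
      simp [neighbors])
  exact ⟨f, hf, fun s ↦ by simpa using hfA s⟩

/-- Proper subsets of a circuit are matchable, so Hall's condition can fail only at the circuit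
itself. -/
lemma IsPresentation.ncard_neighbors_lt_of_isCircuit [Finite E] {M : Matroid E}
    {A : Fin k → Set E} (hA : IsPresentation M A) {C : Set E} (hC : M.IsCircuit C) :
    (neighbors A C).ncard < C.ncard := by
  by_contra! hle
  refine hC.not_indep (hA.indep_iff.2 (exists_isMatching_of_ncard_le_neighbors fun T hT ↦ ?_))
  obtain rfl | hss := hT.eq_or_ssubset
  · exact hle
  obtain ⟨f, hf⟩ := hA.indep_iff.1 (hC.ssubset_indep hss)
  rw [← hf.ncard_image subset_rfl]
  exact ncard_le_ncard hf.image_subset_neighbors (toFinite _)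

/-- The matching of `C \ {e}` already uses `|C| - 1` neighbours of `C`, and there are no more. -/
lemma IsPresentation.neighbors_subset_range_of_isCircuit [Finite E] {M : Matroid E}
    {A : Fin k → Set E} (hA : IsPresentation M A) {C I : Set E} {e : E} (hC : M.IsCircuit C)
    (heC : e ∈ C) (hCI : C \ {e} ⊆ I) {f : I → Fin k} (hf : IsMatching A I f) :
    neighbors A C ⊆ range f := by
  have hlt := hA.ncard_neighbors_lt_of_isCircuit hC
  have hcard := ncard_sdiff_singleton_add_one heC (toFinite C)
  rw [← eq_of_subset_of_ncard_le (hf.image_subset_neighbors.trans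
    (neighbors_mono A sdiff_subset)) (by rw [hf.ncard_image hCI]; lia) (toFinite _)]
  exact image_subset_range _ _

/-! ### Unions of circuits -/

/-- `F` is a union of circuits of `M`. -/
def IsCyclic (M : Matroid E) (F : Set E) : Prop :=
  ∀ x ∈ F, ∃ C ⊆ F, M.IsCircuit C ∧ x ∈ C

/-- If `x ∈ I` lay on no fundamental circuit, `I \ {x}` would span `F \ {x}`. A circuit through `x`
in `F` would then put `x` in the closure of `I \ {x}`, against independence. -/
lemma IsCyclic.exists_isCircuit_subset_insert {M : Matroid E} {F I : Set E} (hF : IsCyclic M F)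
    (hI : M.IsBasis I F) {x : E} (hx : x ∈ F) :
    ∃ e ∈ F, ∃ C ⊆ insert e I, M.IsCircuit C ∧ e ∈ C ∧ x ∈ C := by
  have hcl {e : E} (he : e ∈ F) : e ∈ M.closure I := hI.subset_closure he
  by_cases hxI : x ∈ I
  · by_contra! hno
    obtain ⟨C, hCF, hC, hxC⟩ := hF x hx
    have hsub : F \ {x} ⊆ M.closure (I \ {x}) := by
      rintro e ⟨he, hex⟩
      by_cases heI : e ∈ I
      · exact M.mem_closure_of_mem' ⟨heI, hex⟩ (hI.subset_ground he)
      have hcirc := hI.indep.fundCircuit_isCircuit (hcl he) heI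
      have hemem := M.mem_fundCircuit e I
      have hins := M.fundCircuit_subset_insert e I
      refine M.closure_subset_closure ?_ (hcirc.mem_closure_sdiff_singleton_of_mem hemem)
      rintro y ⟨hy, hye⟩
      refine ⟨(hins hy).resolve_left hye, ?_⟩
      rintro rfl
      exact hno e he _ hins hcirc hemem hy
    refine hI.indep.notMem_closure_sdiff_of_mem hxI ?_
    exact M.closure_subset_closure_of_subset_closure hsub
      (M.closure_subset_closure (sdiff_subset_sdiff_left hCF)
        (hC.mem_closure_sdiff_singleton_of_mem hxC))
  · exact ⟨x, hx, _, M.fundCircuit_subset_insert x I,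
      hI.indep.fundCircuit_isCircuit (hcl hx) hxI, M.mem_fundCircuit x I, M.mem_fundCircuit x I⟩

/-- A cyclic set is adjacent to exactly as many members of a presentation as its rank. -/
lemma IsPresentation.ncard_neighbors_of_isCyclic [Finite E] {M : Matroid E}
    {A : Fin k → Set E} (hA : IsPresentation M A) {F I : Set E} (hF : IsCyclic M F)
    (hI : M.IsBasis I F) : (neighbors A F).ncard = I.ncard := by
  obtain ⟨f, hf⟩ := hA.indep_iff.1 hI.indep
  have hrange : neighbors A F = range f := by
    apply Subset.antisymm
    · rintro j ⟨x, hx, hxj⟩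
      obtain ⟨e, -, C, hCI, hC, heC, hxC⟩ := hF.exists_isCircuit_subset_insert hI hx
      exact hA.neighbors_subset_range_of_isCircuit hC heC (by simpa using hCI) hf ⟨x, hxC, hxj⟩
    · rintro _ ⟨s, rfl⟩
      exact ⟨s, hI.subset s.2, hf.2 s⟩
  rw [hrange, ← image_univ, ncard_image_of_injective _ hf.1, ncard_univ, Nat.card_coe_set_eq]

/-- The number of members of a presentation that avoid a given cyclic set depends only on the
matroid and the number of sets. -/
lemma IsPresentation.ncard_subset_compl_eq [Finite E] {M : Matroid E} {A B : Fin k → Set E}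
    (hA : IsPresentation M A) (hB : IsPresentation M B) {F : Set E} (hF : IsCyclic M F) :
    {j | F ⊆ (A j)ᶜ}.ncard = {j | F ⊆ (B j)ᶜ}.ncard := by
  have key (D : Fin k → Set E) : {j | F ⊆ (D j)ᶜ} = (neighbors D F)ᶜ := by
    ext j
    simp [neighbors, subset_def]
  obtain ⟨I, hI⟩ := M.exists_isBasis F (by rw [hA.1]; exact subset_univ F)
  rw [key, key, ncard_compl, ncard_compl, hA.ncard_neighbors_of_isCyclic hF hI,
    hB.ncard_neighbors_of_isCyclic hF hI]

/-- Two finite families of sets are equal up to a permutation if every set that belongs to one of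
them is contained in equally many members of each. -/
lemma exists_perm_of_ncard_superset_eq [Finite E] {f g : Fin k → Set E}
    (h : ∀ F, F ∈ range f ∪ range g → {j | F ⊆ f j}.ncard = {j | F ⊆ g j}.ncard) :
    ∃ σ : Equiv.Perm (Fin k), ∀ i, f i = g (σ i) := by
  have split (u : Fin k → Set E) (F : Set E) : {j | F ⊆ u j}.ncard =
      {j | u j = F}.ncard + {j | F ⊂ u j}.ncard := by
    rw [← ncard_union_eq _ (toFinite _) (toFinite _)]
    · congr 1
      ext j
      simp [subset_iff_ssubset_or_eq, or_comm, eq_comm]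
    · rw [disjoint_left]
      rintro j hj hj'
      exact hj'.ne hj.symm
  have fiber : ∀ F, {j | f j = F}.ncard = {j | g j = F}.ncard := by
    intro F
    -- The induction runs from larger sets to smaller: the indices with `F ⊂ u j` are counted by the
    -- fibres over strictly larger sets.
    induction F using WellFoundedGT.induction with
    | ind F ih =>
    by_cases hF : F ∈ range f ∪ range g
    · have hss (u : Fin k → Set E) : {j | F ⊂ u j}.ncard =
          ∑ᶠ F' ∈ Ioi F, {j | u j = F'}.ncard := by
        rw [← (toFinite (Ioi F)).ncard_biUnion (fun _ _ ↦ toFinite _)]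
        · congr 1
          ext j
          simp
        · intro F₁ _ F₂ _ hne
          exact disjoint_left.2 fun j h₁ h₂ ↦ hne (h₁.symm.trans h₂)
      have hf := split f F
      have hg := split g F
      have : {j | F ⊂ f j}.ncard = {j | F ⊂ g j}.ncard := by
        rw [hss, hss]
        exact finsum_mem_congr rfl fun F' hF' ↦ ih F' hF'
      have := h F hF
      lia
    · rw [mem_union, not_or] at hF
      rw [show {j | f j = F} = ∅ from eq_empty_of_forall_notMem fun j hj ↦ hF.1 ⟨j, hj⟩,
        show {j | g j = F} = ∅ from eq_empty_of_forall_notMem fun j hj ↦ hF.2 ⟨j, hj⟩]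
  have e (F : Set E) : {j // f j = F} ≃ {j // g j = F} := (Finite.card_eq.1 (fiber F)).some
  refine ⟨(Equiv.sigmaFiberEquiv f).symm.trans ((Equiv.sigmaCongrRight e).trans
    (Equiv.sigmaFiberEquiv g)), fun i ↦ ?_⟩
  exact (e (f i) ⟨i, rfl⟩).2.symm

/-! ### Extension by coloops -/

/-- The union of `S` and the set of coloops of `M ＼ S`. -/
def coloopExtension (M : Matroid E) (S : Set E) : Set E :=
  S ∪ (M.delete S).coloops

lemma subset_coloopExtension (M : Matroid E) (S : Set E) : S ⊆ coloopExtension M S :=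
  subset_union_left

lemma inter_nonempty_of_mem_coloops_delete {M : Matroid E} {S C : Set E} {e : E}
    (he : e ∈ (M.delete S).coloops) (hC : M.IsCircuit C) (heC : e ∈ C) : (C ∩ S).Nonempty := by
  by_contra hdisj
  have hCS : (M.delete S).IsCircuit C :=
    Matroid.delete_isCircuit_iff.2 ⟨hC, disjoint_iff_inter_eq_empty.2
      (not_nonempty_iff_eq_empty.1 hdisj)⟩
  exact Matroid.IsColoop.notMem_isCircuit he hCS heC

lemma isCyclic_compl_coloopExtension {M : Matroid E} (hM : M.E = univ) (S : Set E) :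
    IsCyclic M (coloopExtension M S)ᶜ := by
  intro x hx
  rw [coloopExtension, mem_compl_iff, mem_union, not_or] at hx
  obtain ⟨C, hC, hxC⟩ := Matroid.exists_mem_isCircuit_of_not_isColoop
    (show x ∈ (M.delete S).E by simp [hM, hx.1]) hx.2
  obtain ⟨hCM, hCS⟩ := Matroid.delete_isCircuit_iff.1 hC
  refine ⟨C, ?_, hCM, hxC⟩
  rw [subset_compl_iff_disjoint_right, coloopExtension, disjoint_union_right]
  exact ⟨hCS, hC.disjoint_coloops⟩

/-- Enlarging one member of a presentation by the coloops of the deletion of that member yields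
a presentation of the same matroid. -/
lemma IsPresentation.update_coloopExtension [Finite E] {M : Matroid E} {A : Fin k → Set E}
    (hA : IsPresentation M A) (j : Fin k) :
    IsPresentation M (Function.update A j (coloopExtension M (A j))) := by
  refine ⟨hA.1, fun I ↦ ?_⟩
  rw [isPartialTransversal_iff_exists_isMatching]
  constructor
  · intro hI
    obtain ⟨f, hf⟩ := hA.indep_iff.1 hI
    refine ⟨f, hf.1, fun s ↦ ?_⟩
    obtain hj | hj := eq_or_ne (f s) j
    · rw [hj, Function.update_self]
      exact subset_coloopExtension M _ (hj ▸ hf.2 s)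
    · rw [Function.update_of_ne hj]
      exact hf.2 s
  · rintro ⟨f, hf⟩
    rw [Matroid.indep_iff_forall_subset_not_isCircuit (by rw [hA.1]; exact subset_univ I)]
    intro C hCI hC
    -- The enlarged set gives `C` no new neighbour: if `C` contains an added coloop, it already
    -- meets `A j`.
    refine (hA.ncard_neighbors_lt_of_isCircuit hC).not_ge ?_
    rw [← hf.ncard_image hCI]
    refine ncard_le_ncard ?_ (toFinite _)
    rintro _ ⟨s, hs, rfl⟩
    have hmem := hf.2 s
    obtain hj | hj := eq_or_ne (f s) j
    · rw [hj, Function.update_self] at hmem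
      rw [hj]
      obtain hmem | hmem := hmem
      · exact ⟨s, hs, hmem⟩
      · obtain ⟨x, hxC, hx⟩ := inter_nonempty_of_mem_coloops_delete hmem hC hs
        exact ⟨x, hxC, hx⟩
    · rw [Function.update_of_ne hj] at hmem
      exact ⟨s, hs, hmem⟩

/-! ### Correctness of the algorithm -/

/-- Elements outside `A j` are never matched to `j`, so dropping the right vertex `j` loses no
matching. -/
lemma IsPresentation.isMatchable_iff {M : Matroid E} {A : Fin k → Set E}
    (hA : IsPresentation M A) {j : Fin k} {S : Finset E} :
    IsMatchable (edgesOfFamily A) j S ↔ (M.delete (A j)).Indep S := by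
  rw [Matroid.delete_indep_iff, hA.indep_iff]
  constructor
  · rintro ⟨hS, f, hf, hfS⟩
    exact ⟨⟨fun s ↦ f s, Subtype.val_injective.comp hf, fun s ↦ (hfS s).1⟩,
      disjoint_left.2 fun x hx ↦ hS hx⟩
  · rintro ⟨⟨f, hf, hfS⟩, hS⟩
    have hleft : (S : Set E) ⊆ leftVertices (edgesOfFamily A) j := fun x hx ↦ disjoint_left.1 hS hx
    have hne (s : S) : f s ≠ j := fun h ↦ hleft s.2 (h ▸ hfS s)
    exact ⟨hleft, fun s ↦ ⟨f s, hne s⟩, fun s t hst ↦ hf (congrArg Subtype.val hst),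
      fun s ↦ ⟨hfS s, hleft s.2, hne s⟩⟩

lemma IsPresentation.mem_maximumMatchable_iff [Finite E] {M : Matroid E} {A : Fin k → Set E}
    (hA : IsPresentation M A) {j : Fin k} {S : Finset E} :
    S ∈ maximumMatchable (edgesOfFamily A) j ↔ (M.delete (A j)).IsBase S := by
  simp only [maximumMatchable, mem_ofPred_eq, hA.isMatchable_iff]
  constructor
  · rintro ⟨hS, hmax⟩
    obtain ⟨B, hB, hSB⟩ := hS.exists_isBase_superset
    have hle := hmax (toFinite B).toFinset (by simpa using hB.indep)
    rw [← ncard_eq_toFinset_card, ← ncard_coe_finset] at hle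
    rwa [eq_of_subset_of_ncard_le hSB hle (toFinite B)]
  · intro hS
    refine ⟨hS.indep, fun S' hS' ↦ ?_⟩
    obtain ⟨B, hB, hSB⟩ := hS'.exists_isBase_superset
    rw [← ncard_coe_finset, ← ncard_coe_finset, hS.ncard_eq_ncard_of_isBase hB]
    exact ncard_le_ncard hSB (toFinite B)

lemma IsPresentation.step_edgesOfFamily [Finite E] {M : Matroid E} {A : Fin k → Set E}
    (hA : IsPresentation M A) (j : Fin k) : step (edgesOfFamily A) j =
      edgesOfFamily (Function.update A j (coloopExtension M (A j))) := by
  have hcoloop (e : E) : (∀ S ∈ maximumMatchable (edgesOfFamily A) j, e ∈ S) ↔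
      e ∈ (M.delete (A j)).coloops := by
    rw [← Matroid.isColoop_iff_mem_coloops, Matroid.isColoop_iff_forall_mem_isBase]
    constructor
    · intro h B hB
      simpa using h (toFinite B).toFinset (hA.mem_maximumMatchable_iff.2 (by simpa using hB))
    · intro h S hS
      simpa using h (hA.mem_maximumMatchable_iff.1 hS)
  ext ⟨e, i⟩
  simp only [step, hcoloop]
  obtain rfl | hi := eq_or_ne i j
  · simp [edgesOfFamily, coloopExtension]
  · simp [edgesOfFamily, hi]

/-- Running the body of the loop over distinct columns extends exactly the corresponding members
of the presentation by the coloops of their deletions. -/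
lemma IsPresentation.foldl_step [Finite E] {M : Matroid E} {l : List (Fin k)} (hl : l.Nodup)
    {A : Fin k → Set E} (hA : IsPresentation M A) :
    let B : Fin k → Set E := fun j ↦ if j ∈ l then coloopExtension M (A j) else A j
    IsPresentation M B ∧ l.foldl step (edgesOfFamily A) = edgesOfFamily B := by
  induction l generalizing A with
  | nil => simpa using hA
  | cons j l ih =>
    obtain ⟨hj, hl⟩ := List.nodup_cons.1 hl
    -- The matroid is unchanged and `j` does not recur in `l`, so later steps still see the original
    -- sets.
    have key := ih hl (hA.update_coloopExtension j)
    have hfun : (fun i ↦ if i ∈ l then coloopExtension M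
          (Function.update A j (coloopExtension M (A j)) i)
          else Function.update A j (coloopExtension M (A j)) i) =
        fun i ↦ if i ∈ j :: l then coloopExtension M (A i) else A i := by
      funext i
      obtain rfl | hi := eq_or_ne i j
      · simp [hj]
      · simp [hi]
    rw [hfun] at key
    rwa [List.foldl_cons, hA.step_edgesOfFamily j]

lemma IsPresentation.isPresentation_coloopExtension [Finite E] {M : Matroid E} {A : Fin k → Set E}
    (hA : IsPresentation M A) : IsPresentation M fun j ↦ coloopExtension M (A j) := by
  simpa using (hA.foldl_step (List.nodup_finRange k)).1

lemma edgesOfMatrix_biadjacency (G : Set (E × Fin k)) : edgesOfMatrix (biadjacency G) = G := by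
  ext ⟨e, j⟩
  simp [edgesOfMatrix, biadjacency]

lemma IsPresentation.isRepresentation_algorithm [Finite E] {M : Matroid E} {A : Fin k → Set E}
    (hA : IsPresentation M A) {X : Matrix E (Fin k) ℕ} (hX : IsRepresentation A X) :
    IsRepresentation (fun j ↦ coloopExtension M (A j)) (algorithm X) := by
  rw [IsRepresentation] at hX
  rw [IsRepresentation, algorithm, hX, edgesOfMatrix_biadjacency,
    (hA.foldl_step (List.nodup_finRange k)).2]
  simp

/-! ### Uniqueness and maximality -/

/-- The coloop extensions of two presentations with equally many sets agree up to a permutation. -/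
lemma IsPresentation.exists_perm_coloopExtension_eq [Finite E] {M : Matroid E}
    {A C : Fin k → Set E} (hA : IsPresentation M A) (hC : IsPresentation M C) :
    ∃ σ : Equiv.Perm (Fin k), ∀ i, coloopExtension M (A i) =
      coloopExtension M (C (σ i)) := by
  obtain ⟨σ, hσ⟩ := exists_perm_of_ncard_superset_eq
    (f := fun i ↦ (coloopExtension M (A i))ᶜ)
    (g := fun i ↦ (coloopExtension M (C i))ᶜ) (by
      rintro _ (⟨i, rfl⟩ | ⟨i, rfl⟩) <;>
      exact hA.isPresentation_coloopExtension.ncard_subset_compl_eq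
        hC.isPresentation_coloopExtension (isCyclic_compl_coloopExtension hA.1 _))
  exact ⟨σ, fun i ↦ compl_injective (hσ i)⟩

lemma IsPresentation.presentationLE_coloopExtension [Finite E] {M : Matroid E}
    {A C : Fin k → Set E} (hA : IsPresentation M A) (hC : IsPresentation M C) :
    PresentationLE C fun j ↦ coloopExtension M (A j) := by
  obtain ⟨σ, hσ⟩ := hA.exists_perm_coloopExtension_eq hC
  refine ⟨σ, fun i ↦ ?_⟩
  exact (subset_coloopExtension M _).trans (hσ i).ge

/-- The two relations force equal total cardinalities, so every inclusion is an equality. -/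
lemma PresentationLE.exists_perm_eq [Finite E] {A B : Fin k → Set E} (hAB : PresentationLE A B)
    (hBA : PresentationLE B A) : ∃ σ : Equiv.Perm (Fin k), ∀ i, A i = B (σ i) := by
  obtain ⟨σ, hσ⟩ := hAB
  obtain ⟨τ, hτ⟩ := hBA
  have hle (i : Fin k) : (A (σ i)).ncard ≤ (B i).ncard := ncard_le_ncard (hσ i) (toFinite _)
  have hsum : ∑ i, (A (σ i)).ncard = ∑ i, (B i).ncard := by
    refine le_antisymm (Finset.sum_le_sum fun i _ ↦ hle i) ?_
    rw [Equiv.sum_comp σ fun i ↦ (A i).ncard, ← Equiv.sum_comp τ fun i ↦ (B i).ncard]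
    exact Finset.sum_le_sum fun i _ ↦ ncard_le_ncard (hτ i) (toFinite _)
  have heq := (Finset.sum_eq_sum_iff_of_le fun i _ ↦ hle i).1 hsum
  refine ⟨σ.symm, fun i ↦ ?_⟩
  have h := eq_of_subset_of_ncard_le (hσ (σ.symm i)) (heq _ (Finset.mem_univ _)).ge (toFinite _)
  simpa using h

end TransversalPresentation

open TransversalPresentation in
theorem mainTheorem1 {E : Type*} [Finite E] {r : ℕ} (M : Matroid E) (A : Fin r → Set E)
    (X : Matrix E (Fin r) ℕ) (hX : IsViableRepresentation M A X) :
    IsMaximalRepresentation M (algorithm X) ∧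
    ∃ B : Fin r → Set E,
      IsRepresentation B (algorithm X) ∧
      (∀ j : Fin r, B j = A j ∪ (M.delete (A j)).coloops) ∧
      IsMaximalPresentation M B ∧
      (∀ C : Fin r → Set E, IsPresentation M C → PresentationLE C B) ∧
      (∀ C : Fin r → Set E, IsMaximalPresentation M C →
        ∃ σ : Equiv.Perm (Fin r), ∀ i, C i = B (σ i)) := by
  obtain ⟨hA, hAX, hr⟩ := hX
  have hrep := hA.isRepresentation_algorithm hAX
  have hmax : IsMaximalPresentation M fun j ↦ coloopExtension M (A j) :=
    ⟨hA.isPresentation_coloopExtension, hr, fun C hC _ ↦ hA.presentationLE_coloopExtension hC⟩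
  refine ⟨⟨_, hmax, hrep⟩, _, hrep, fun _ ↦ rfl, hmax,
    fun C hC ↦ hA.presentationLE_coloopExtension hC, fun C hC ↦ ?_⟩
  have hle := hA.presentationLE_coloopExtension hC.1
  exact hle.exists_perm_eq (hC.2.2 _ hmax.1 hle)
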